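/- A cover of a topological space $X$ is a family $\mathcal U$ of subsets of $X$ with $\bigcup\mathcal U=X$ and $X\notin\mathcal U$. It is an $\omega$-cover if each finite subset of $X$ is contained in some member of $\mathcal U$, and a $\gamma$-cover if $\mathcal U$ is infinite and each $x\in X$ belongs to all but finitely many members of $\mathcal U$. Let $\mathrm O(X)$ and $\Gamma(X)$ be the families of open covers and of open $\gamma$-covers of $X$, and let $\mathrm B_\Omega(X)$ and $\mathrm B_\Gamma(X)$ be the families of countable $\omega$-covers and of countable $\gamma$-covers of $X$ by Borel sets. For families $\mathscr A,\mathscr B$ of covers: * $\mathsf S_1(\mathscr A,\mathscr B)$: for all $\mathcal U_1,\mathcal U_2,\dots\in\mathscr A$ there are $U_n\in\mathcal U_n$ such that $\{U_n:n\in\mathbb N\}\in\mathscr B$. * $\mathsf S_{\mathrm{fin}}(\mathscr A,\mathscr B)$: for all $\mathcal U_1,\mathcal U_2,\dots\in\mathscr A$ there are finite $\mathcal F_n\subseteq\mathcal U_n$ such that $\bigcup_n\mathcal F_n\in\mathscr B$. * $\mathsf U_{\mathrm{fin}}(\mathscr A,\mathscr B)$: for all $\mathcal U_1,\mathcal U_2,\dots\in\mathscr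 A$, none containing a finite subcover, there are finite $\mathcal F_n\subseteq\mathcal U_n$ such that $\{\bigcup\mathcal F_n:n\in\mathbb N\}\in\mathscr B$. A space $X$ satisfies such a principle if the principle holds for the corresponding families of covers of $X$, and satisfies it hereditarily if every subspace of $X$ satisfies it. $X$ is a $\sigma$-space if every Borel subset of $X$ is an $F_\sigma$ subset of $X$. **Theorem.** Assume the Continuum Hypothesis. 1. There is a subgroup $G$ of $(\mathbb R,+)$ of cardinality continuum such that every finite power $G^k$ satisfies $\mathsf S_1(\mathrm B_\Omega,\mathrm B_\Omega)$ hereditarily, but $G$ is not a $\sigma$-space and does not satisfy $\mathsf U_{\mathrm{fin}}(\mathrm O,\Gamma)$. 2. There is a subgroup $H$ of $(\mathbb R,+)$ of cardinality continuum such that every finite power $H^k$ satisfies both $\mathsf S_1(\mathrm B_\Gamma,\mathrm B_\Gamma)$ and $\mathsf S_{\mathrm{fin}}(\mathrm B_\Omega,\mathrm B_\Omega)$ hereditarily, but $H$ does not satisfy $\mathsf S_1(\mathrm O,\mathrm O)$. -/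

import Mathlib

open Cardinal

/-! Families of covers. A cover of `X` is a family of subsets of `X` whose union is `X` and which
does not have `X` itself as a member. -/

namespace SelectionPrinciples

universe u

section Covers

variable (X : Type u)

/-- `𝒰` is a cover of `X`: its union is `X`, but `X` is not a member of it. -/
def IsCover (𝒰 : Set (Set X)) : Prop :=
  ⋃₀ 𝒰 = Set.univ ∧ Set.univ ∉ 𝒰

/-- Each finite subset of `X` is contained in some member of `𝒰`. -/
def IsOmegaFamily (𝒰 : Set (Set X)) : Prop :=
  ∀ F : Set X, F.Finite → ∃ U ∈ 𝒰, F ⊆ U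

/-- `𝒰` is infinite, and each point of `X` belongs to all but finitely many members of `𝒰`. -/
def IsGammaFamily (𝒰 : Set (Set X)) : Prop :=
  𝒰.Infinite ∧ ∀ x : X, {U ∈ 𝒰 | x ∉ U}.Finite

variable [TopologicalSpace X]

/-- `O(X)`: the open covers of `X`. -/
def OpenCovers : Set (Set (Set X)) :=
  {𝒰 | IsCover X 𝒰 ∧ ∀ U ∈ 𝒰, IsOpen U}

/-- `Γ(X)`: the open `γ`-covers of `X`. -/
def OpenGammaCovers : Set (Set (Set X)) :=
  {𝒰 | 𝒰 ∈ OpenCovers X ∧ IsGammaFamily X 𝒰}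

/-- The countable covers of `X` by Borel sets. -/
def BorelCovers : Set (Set (Set X)) :=
  {𝒰 | IsCover X 𝒰 ∧ 𝒰.Countable ∧ ∀ U ∈ 𝒰, @MeasurableSet X (borel X) U}

/-- `B_Ω(X)`: the countable Borel `ω`-covers of `X`. -/
def BorelOmegaCovers : Set (Set (Set X)) :=
  {𝒰 | 𝒰 ∈ BorelCovers X ∧ IsOmegaFamily X 𝒰}

/-- `B_Γ(X)`: the countable Borel `γ`-covers of `X`. -/
def BorelGammaCovers : Set (Set (Set X)) :=
  {𝒰 | 𝒰 ∈ BorelCovers X ∧ IsGammaFamily X 𝒰}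

end Covers

section Principles

variable {X : Type u}

/-- The selection principle `S₁(𝒜, ℬ)`. -/
def S1 (𝒜 ℬ : Set (Set (Set X))) : Prop :=
  ∀ 𝒰 : ℕ → Set (Set X), (∀ n, 𝒰 n ∈ 𝒜) →
    ∃ U : ℕ → Set X, (∀ n, U n ∈ 𝒰 n) ∧ Set.range U ∈ ℬ

/-- The selection principle `S_fin(𝒜, ℬ)`. -/
def Sfin (𝒜 ℬ : Set (Set (Set X))) : Prop :=
  ∀ 𝒰 : ℕ → Set (Set X), (∀ n, 𝒰 n ∈ 𝒜) →
    ∃ ℱ : ℕ → Set (Set X), (∀ n, ℱ n ⊆ 𝒰 n ∧ (ℱ n).Finite) ∧ (⋃ n, ℱ n) ∈ ℬ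

/-- The selection principle `U_fin(𝒜, ℬ)`; only sequences of families none of which contains a
finite subcover are considered. -/
def Ufin (𝒜 ℬ : Set (Set (Set X))) : Prop :=
  ∀ 𝒰 : ℕ → Set (Set X), (∀ n, 𝒰 n ∈ 𝒜) →
    (∀ n, ¬ ∃ ℱ : Set (Set X), ℱ ⊆ 𝒰 n ∧ ℱ.Finite ∧ ⋃₀ ℱ = Set.univ) →
    ∃ ℱ : ℕ → Set (Set X), (∀ n, ℱ n ⊆ 𝒰 n ∧ (ℱ n).Finite) ∧
      Set.range (fun n => ⋃₀ ℱ n) ∈ ℬ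

end Principles

section Properties

/-- `S₁(O, O)` (Rothberger's property). -/
def S1OO (X : Type u) [TopologicalSpace X] : Prop :=
  S1 (OpenCovers X) (OpenCovers X)

/-- `U_fin(O, Γ)` (Hurewicz's property). -/
def UfinOGamma (X : Type u) [TopologicalSpace X] : Prop :=
  Ufin (OpenCovers X) (OpenGammaCovers X)

/-- `S₁(B_Ω, B_Ω)`. -/
def S1BOmegaBOmega (X : Type u) [TopologicalSpace X] : Prop :=
  S1 (BorelOmegaCovers X) (BorelOmegaCovers X)

/-- `S₁(B_Γ, B_Γ)`. -/
def S1BGammaBGamma (X : Type u) [TopologicalSpace X] : Prop :=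
  S1 (BorelGammaCovers X) (BorelGammaCovers X)

/-- `S_fin(B_Ω, B_Ω)`. -/
def SfinBOmegaBOmega (X : Type u) [TopologicalSpace X] : Prop :=
  Sfin (BorelOmegaCovers X) (BorelOmegaCovers X)

/-- `X` satisfies `P` hereditarily: each subspace of `X` satisfies `P`. -/
def Hereditarily (P : ∀ (Y : Type u) [TopologicalSpace Y], Prop)
    (X : Type u) [TopologicalSpace X] : Prop :=
  ∀ Y : Set X, P Y

/-- `A` is an `F_σ` subset of `X`: a union of countably many closed subsets of `X`. -/
def IsFSigma {X : Type u} [TopologicalSpace X] (A : Set X) : Prop :=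
  ∃ C : ℕ → Set X, (∀ n, IsClosed (C n)) ∧ A = ⋃ n, C n

/-- `X` is a `σ`-space: each Borel subset of `X` is an `F_σ` subset of `X`. -/
def IsSigmaSpace (X : Type u) [TopologicalSpace X] : Prop :=
  ∀ A : Set X, @MeasurableSet X (borel X) A → IsFSigma A

end Properties

end SelectionPrinciples

namespace SelectionPrinciples

open Set Filter

/-! ### Small sets -/

/-- A notion of smallness for subsets of measurable spaces which is hereditary, countably additive
and preserved by measurable images. -/
structure IsSmallness (P : ∀ (E : Type) [MeasurableSpace E], Set E → Prop) : Prop where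
  mono : ∀ (E : Type) [MeasurableSpace E] (s t : Set E), s ⊆ t → P E t → P E s
  iUnion_nat : ∀ (E : Type) [MeasurableSpace E] (s : ℕ → Set E), (∀ n, P E (s n)) → P E (⋃ n, s n)
  image : ∀ (E E' : Type) [MeasurableSpace E] [MeasurableSpace E'] (f : E → E') (s : Set E),
    Measurable f → P E s → P E' (f '' s)
  empty : ∀ (E : Type) [MeasurableSpace E], P E ∅

theorem IsSmallness.iUnion {P : ∀ (E : Type) [MeasurableSpace E], Set E → Prop}
    (hP : IsSmallness P) {E : Type} [MeasurableSpace E] {ι : Type*} [Countable ι] (s : ι → Set E)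
    (h : ∀ i, P E (s i)) : P E (⋃ i, s i) := by
  rcases isEmpty_or_nonempty ι with hι | hι
  · simpa using hP.empty E
  · obtain ⟨f, hf⟩ := exists_surjective_nat ι
    rw [← hf.iUnion_comp]
    exact hP.iUnion_nat E _ fun n => h _

/-- Any sequence of countable measurable covers of `s` admits a choice of one member of each cover,
such that the chosen sets cover `s`. -/
def IsBorelRothberger (E : Type) [MeasurableSpace E] (s : Set E) : Prop :=
  ∀ B : ℕ → ℕ → Set E, (∀ n j, MeasurableSet (B n j)) → (∀ n, s ⊆ ⋃ j, B n j) →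
    ∃ g : ℕ → ℕ, s ⊆ ⋃ n, B n (g n)

/-- Any sequence of countable measurable covers of `s` admits a choice of finite subfamilies
such that each point of `s` is covered by all but finitely many of them. -/
def IsBorelHurewicz (E : Type) [MeasurableSpace E] (s : Set E) : Prop :=
  ∀ B : ℕ → ℕ → Set E, (∀ n j, MeasurableSet (B n j)) → (∀ n, s ⊆ ⋃ j, B n j) →
    ∃ g : ℕ → ℕ, ∀ x ∈ s, ∀ᶠ n in atTop, ∃ j ≤ g n, x ∈ B n j

/-- A sequence of countable measurable covers of a set `s` extends to a sequence of countable
measurable covers of the whole space with the same traces on `s`. -/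
theorem exists_measurable_cover_univ {E : Type} [MeasurableSpace E] {s : Set E} {B : ℕ → ℕ → Set E}
    (hB : ∀ n j, MeasurableSet (B n j)) (hs : ∀ n, s ⊆ ⋃ j, B n j) :
    ∃ B' : ℕ → ℕ → Set E, (∀ n j, MeasurableSet (B' n j)) ∧ (∀ n, ⋃ j, B' n j = Set.univ) ∧
      ∀ n j, ∀ x ∈ s, x ∈ B' n j → x ∈ B n j := by
  refine ⟨fun n j => B n j ∪ (⋃ j, B n j)ᶜ,
    fun n j => (hB n j).union (MeasurableSet.iUnion (hB n)).compl, fun n => ?_, ?_⟩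
  · rw [eq_univ_iff_forall]
    intro x
    by_cases hx : x ∈ ⋃ j, B n j
    · obtain ⟨j, hj⟩ := mem_iUnion.1 hx
      exact mem_iUnion.2 ⟨j, Or.inl hj⟩
    · exact mem_iUnion.2 ⟨0, Or.inr hx⟩
  · rintro n j x hx (h | h)
    · exact h
    · exact absurd (hs n hx) h

/-- For a countable union, the covers are split by `Nat.pair` into infinitely many subsequences, one
spent on each piece. -/
theorem isSmallness_isBorelRothberger : IsSmallness IsBorelRothberger where
  mono E _ s t hst ht B hB hs := by
    obtain ⟨B', hB', hu, hsub⟩ := exists_measurable_cover_univ hB hs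
    obtain ⟨g, hg⟩ := ht B' hB' fun n => (hu n).symm ▸ subset_univ t
    refine ⟨g, fun x hx => ?_⟩
    obtain ⟨n, hn⟩ := mem_iUnion.1 (hg (hst hx))
    exact mem_iUnion.2 ⟨n, hsub n _ x hx hn⟩
  iUnion_nat E _ s h B hB hs := by
    have : ∀ i, ∃ g : ℕ → ℕ, s i ⊆ ⋃ n, B (Nat.pair i n) (g n) := fun i =>
      h i (fun n => B (Nat.pair i n)) (fun n => hB _)
        fun n => (subset_iUnion s i).trans (hs _)
    choose g hg using this
    refine ⟨fun n => g n.unpair.1 n.unpair.2, iUnion_subset fun i x hx => ?_⟩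
    obtain ⟨n, hn⟩ := mem_iUnion.1 (hg i hx)
    exact mem_iUnion.2 ⟨Nat.pair i n, by simpa using hn⟩
  image E E' _ _ f s hf h B hB hs := by
    obtain ⟨g, hg⟩ := h (fun n j => f ⁻¹' B n j) (fun n j => hf (hB n j)) fun n x hx => by
      simpa using hs n (mem_image_of_mem f hx)
    refine ⟨g, ?_⟩
    rintro _ ⟨x, hx, rfl⟩
    simpa using hg hx
  empty E _ B _ _ := ⟨0, empty_subset _⟩

/-- For a countable union, a diagonal bound dominates the bound of each piece from some index on. -/
theorem isSmallness_isBorelHurewicz : IsSmallness IsBorelHurewicz where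
  mono E _ s t hst ht B hB hs := by
    obtain ⟨B', hB', hu, hsub⟩ := exists_measurable_cover_univ hB hs
    obtain ⟨g, hg⟩ := ht B' hB' fun n => (hu n).symm ▸ subset_univ t
    refine ⟨g, fun x hx => (hg x (hst hx)).mono ?_⟩
    rintro n ⟨j, hj, hxj⟩
    exact ⟨j, hj, hsub n _ x hx hxj⟩
  iUnion_nat E _ s h B hB hs := by
    choose g hg using fun i => h i B hB fun n => (subset_iUnion s i).trans (hs _)
    refine ⟨fun n => (Finset.range (n + 1)).sup fun i => g i n, fun x hx => ?_⟩
    obtain ⟨i, hi⟩ := mem_iUnion.1 hx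
    filter_upwards [hg i x hi, eventually_ge_atTop i]
    rintro n ⟨j, hj, hxj⟩ hin
    exact ⟨j, hj.trans (Finset.le_sup (f := fun i => g i n)
      (Finset.mem_range.2 (Nat.lt_succ_of_le hin))), hxj⟩
  image E E' _ _ f s hf h B hB hs := by
    obtain ⟨g, hg⟩ := h (fun n j => f ⁻¹' B n j) (fun n j => hf (hB n j)) fun n x hx => by
      simpa using hs n (mem_image_of_mem f hx)
    refine ⟨g, ?_⟩
    rintro _ ⟨x, hx, rfl⟩
    simpa using hg x hx
  empty E _ B _ _ := ⟨0, fun x hx => hx.elim⟩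

/-! ### Generic sequences -/

/-- A filter on the real line together with filters on its finite powers, subject to a
Kuratowski–Ulam or Fubini type law. -/
structure IsFubiniFamily (l : Filter ℝ) (F : ∀ m : ℕ, Filter (Fin m → ℝ)) : Prop where
  neBot : l.NeBot
  countableInter : CountableInterFilter l
  ne : ∀ a, ∀ᶠ x in l, x ≠ a
  zero : ∀ C ∈ F 0, ∀ v, v ∈ C
  one : ∀ C ∈ l, {v | v 0 ∈ C} ∈ F 1
  succ : ∀ m, ∀ C ∈ F (m + 1), ∀ᶠ x in l, {v | (Fin.cons x v : Fin (m + 1) → ℝ) ∈ C} ∈ F m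

/-- The values of `x` are eventually generic: all increasing tuples with large indices belong to a
given measurable set in the filter. -/
def IsGenericSeq (F : ∀ m : ℕ, Filter (Fin m → ℝ)) {I : Type} [LinearOrder I] (x : I → ℝ) : Prop :=
  ∀ (m : ℕ) (C : Set (Fin m → ℝ)), MeasurableSet C → C ∈ F m →
    ∃ b : I, ∀ c : Fin m → I, StrictMono c → (∀ i, b ≤ c i) → x ∘ c ∈ C

theorem exists_recursive_choice {I : Type} [LinearOrder I] [WellFoundedLT I]
    (hI : ∀ a : I, (Iio a).Countable) (R : I → Set ℝ → ℝ → Prop)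
    (hR : ∀ a s, s.Countable → ∃ y, R a s y) :
    ∃ x : I → ℝ, ∀ a, R a (x '' Iio a) (x a) := by
  classical
  let step (a : I) (ih : (b : I) → b < a → ℝ) : ℝ :=
    if h : ∃ y, R a (range fun b : Iio a => ih b.1 b.2) y then h.choose else 0
  let x : I → ℝ := (wellFounded_lt (α := I)).fix step
  have hx : ∀ a, x a = step a fun b _ => x b := fun a => WellFounded.fix_eq _ _ _
  refine ⟨x, fun a => ?_⟩
  have hr : (range fun b : Iio a => x b.1) = x '' Iio a := by
    rw [image_eq_range]
  have h : ∃ y, R a (range fun b : Iio a => x b.1) y := by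
    rw [hr]
    exact hR a _ ((hI a).image x)
  rw [hx a, ← hr]
  simp only [step]
  rw [dif_pos h]
  exact h.choose_spec

theorem mk_sigma_measurableSet_le :
    #(Σ m : ℕ, {C : Set (Fin m → ℝ) // MeasurableSet C}) ≤ 𝔠 := by
  rw [mk_sigma]
  have h (m : ℕ) : #{C : Set (Fin m → ℝ) // MeasurableSet C} ≤ 𝔠 := by
    obtain ⟨b, hb, hgen⟩ :=
      MeasurableSpace.CountablyGenerated.isCountablyGenerated (α := Fin m → ℝ)
    rw [hgen]
    exact MeasurableSpace.cardinal_measurableSet_le_continuum (hb.le_aleph0.trans aleph0_le_continuum)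
  calc Cardinal.sum (fun m : ℕ => #{C : Set (Fin m → ℝ) // MeasurableSet C})
      ≤ Cardinal.sum fun _ : ℕ => 𝔠 := sum_le_sum _ _ h
    _ = 𝔠 := by simp

/-- At stage `a` only countably many Borel sets and finite lists of earlier values have been met.
Each asks that a large section stay large after fixing one more coordinate, which holds for
`l`-almost every choice of that coordinate, so one value serves all. -/
theorem exists_isGenericSeq (CH : (𝔠 : Cardinal.{0}) = ℵ₁) {l : Filter ℝ}
    {F : ∀ m : ℕ, Filter (Fin m → ℝ)} (hF : IsFubiniFamily l F) :
    ∃ (I : Type) (_ : LinearOrder I) (x : I → ℝ), #I = 𝔠 ∧ (∀ a : I, (Iio a).Countable) ∧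
      Function.Injective x ∧ IsGenericSeq F x := by
  have := hF.neBot
  have := hF.countableInter
  obtain ⟨I, hlo, hwf, hcard, hI⟩ : ∃ (I : Type) (_ : LinearOrder I), WellFoundedLT I ∧ #I = 𝔠 ∧
      ∀ a : I, (Iio a).Countable := by
    refine ⟨(ℵ₁ : Cardinal.{0}).ord.ToType, inferInstance, inferInstance, by simp [CH], fun a => ?_⟩
    have h := Cardinal.mk_Iio_lt a (by simp)
    rw [← le_aleph0_iff_set_countable, ← Order.lt_succ_iff, succ_aleph0]
    simpa using h
  have hne : Nonempty I := mk_ne_zero_iff.1 (hcard ▸ continuum_ne_zero)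
  obtain ⟨e, he⟩ : ∃ e : I → Σ m : ℕ, {C : Set (Fin m → ℝ) // MeasurableSet C},
      Function.Surjective e := by
    have : Nonempty (Σ m : ℕ, {C : Set (Fin m → ℝ) // MeasurableSet C}) :=
      ⟨⟨0, ∅, MeasurableSet.empty⟩⟩
    obtain ⟨f⟩ := mk_sigma_measurableSet_le.trans_eq hcard.symm
    exact ⟨Function.invFun f, Function.invFun_surjective f.injective⟩
  -- Tuples are coded as lists so that sections of every dimension live in a single type.
  let A (b : I) : Set (List ℝ) := List.ofFn '' (e b).2.1
  let Large (m : ℕ) (T : Set (List ℝ)) : Prop := {v : Fin m → ℝ | List.ofFn v ∈ T} ∈ F m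
  let Sec (T : Set (List ℝ)) (s : List ℝ) : Set (List ℝ) := {t | s ++ t ∈ T}
  obtain ⟨x, hx⟩ := exists_recursive_choice hI
    (fun a S y => (∀ z ∈ S, y ≠ z) ∧ ∀ b ≤ a, ∀ s ∈ {s : List ℝ | ∀ z ∈ s, z ∈ S}, ∀ m,
      Large (m + 1) (Sec (A b) s) → Large m (Sec (A b) (s ++ [y])))
    (by
      intro a S hS
      have hIic : (Iic a).Countable := by
        rw [← Iio_insert]
        exact (hI a).insert a
      have hL : {s : List ℝ | ∀ z ∈ s, z ∈ S}.Countable := by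
        have := hS.to_subtype
        refine (countable_range fun s : List S => s.map Subtype.val).mono fun s hs => ?_
        exact ⟨s.pmap Subtype.mk hs, by simp [List.map_pmap]⟩
      refine Eventually.exists (f := l) (Eventually.and ?_ ?_)
      · exact (eventually_countable_ball hS).2 fun z _ => hF.ne z
      · refine (eventually_countable_ball hIic).2 fun b _ => (eventually_countable_ball hL).2
          fun s _ => eventually_countable_forall.2 fun m => ?_
        by_cases h : Large (m + 1) (Sec (A b) s)
        · refine (hF.succ m _ h).mono fun y hy _ => ?_
          simpa [Large, Sec, List.ofFn_succ] using hy
        · exact Eventually.of_forall fun y hy => absurd hy h)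
  refine ⟨I, hlo, x, hcard, hI, fun a b hab => ?_, fun m C hC hCF => ?_⟩
  · by_contra hne
    rcases lt_or_gt_of_ne hne with h | h
    · exact (hx b).1 _ (mem_image_of_mem x h) hab.symm
    · exact (hx a).1 _ (mem_image_of_mem x h) hab
  · obtain ⟨b, hb⟩ := he ⟨m, C, hC⟩
    refine ⟨b, fun c hc hbc => ?_⟩
    -- The coordinates in `s` are already fixed and those in `t` are still free. Largeness survives
    -- each move from `t` to `s`; in dimension zero it becomes membership.
    have key : ∀ (t s : List I), (s ++ t).Pairwise (· < ·) → (∀ i ∈ t, b ≤ i) →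
        Large t.length (Sec (A b) (s.map x)) → (s ++ t).map x ∈ A b := by
      intro t
      induction t with
      | nil =>
        intro s _ _ h
        simpa [Sec] using hF.zero _ h Fin.elim0
      | cons a t ih =>
        intro s hs hbt h
        have := ih (s ++ [a]) (by simpa using hs) (fun i hi => hbt i (by simp [hi])) ?_
        · simpa using this
        · rw [List.map_append]
          refine (hx a).2 b (hbt a (by simp)) (s.map x) ?_ t.length h
          intro z hz
          obtain ⟨i, hi, rfl⟩ := List.mem_map.1 hz
          exact mem_image_of_mem x ((List.pairwise_append.1 hs).2.2 i hi a (by simp))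
    have hA : A b = List.ofFn '' C := by
      change List.ofFn '' (e b).2.1 = _
      rw [hb]
    have := key (List.ofFn c) [] (by
      simpa [List.pairwise_ofFn] using fun i j hij => hc hij) (by
      simpa [List.forall_mem_ofFn_iff] using hbc) (by
      simp only [Large, Sec, hA, List.map_nil, List.nil_append, List.length_ofFn]
      simpa [List.ofFn_injective.mem_set_image] using hCF)
    rw [hA] at this
    simpa [List.ofFn_injective.mem_set_image] using this

/-- The increasing `m`-tuples of values of `x`. -/
def increasingTuples {I : Type} [LinearOrder I] (x : I → ℝ) (m : ℕ) : Set (Fin m → ℝ) :=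
  {v | ∃ c : Fin m → I, StrictMono c ∧ v = x ∘ c}

/-- By genericity an increasing tuple outside a large Borel set starts below some `b`. There are
countably many such first entries, and fixing one leaves an image of the shorter tuples. -/
theorem IsSmallness.increasingTuples {P : ∀ (E : Type) [MeasurableSpace E], Set E → Prop}
    (hP : IsSmallness P) {l : Filter ℝ} {F : ∀ m : ℕ, Filter (Fin m → ℝ)} (hF : IsFubiniFamily l F)
    (hPF : ∀ m (s : Set (Fin m → ℝ)),
      (∀ C, MeasurableSet C → C ∈ F m → P _ (s \ C)) → P _ s)
    {I : Type} [LinearOrder I] {x : I → ℝ} (hI : ∀ a : I, (Iio a).Countable)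
    (hx : IsGenericSeq F x) (m : ℕ) : P _ (increasingTuples x m) := by
  induction m with
  | zero =>
    refine hPF 0 _ fun C _ hC => ?_
    rw [show SelectionPrinciples.increasingTuples x 0 \ C = ∅ from
      eq_empty_of_forall_notMem fun v hv => hv.2 (hF.zero C hC v)]
    exact hP.empty _
  | succ m ih =>
    refine hPF _ _ fun C hCm hC => ?_
    obtain ⟨b, hb⟩ := hx _ C hCm hC
    have := (hI b).to_subtype
    refine hP.mono _ _ _ ?_ (hP.iUnion
      (fun a : Iio b => (fun v : Fin m → ℝ => (Fin.cons (x a) v : Fin (m + 1) → ℝ)) ''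
        SelectionPrinciples.increasingTuples x m) fun a => hP.image _ _ _ _ ?_ ih)
    · rintro _ ⟨⟨c, hc, rfl⟩, hvC⟩
      have h0 : c 0 < b := by
        by_contra h
        exact hvC (hb c hc fun i => (not_lt.1 h).trans (hc.monotone (Fin.zero_le i)))
      refine mem_iUnion.2 ⟨⟨c 0, h0⟩, x ∘ c ∘ Fin.succ,
        ⟨c ∘ Fin.succ, hc.comp (Fin.strictMono_succ), rfl⟩, ?_⟩
      ext i
      refine Fin.cases ?_ (fun i => ?_) i <;> simp
    · refine measurable_pi_lambda _ fun i => ?_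
      refine Fin.cases ?_ (fun i => ?_) i
      · simp
      · simpa using measurable_pi_apply i

/-- The subgroup generated by the values of `x`. -/
noncomputable def genericGroup {I : Type} (x : I → ℝ) : AddSubgroup ℝ :=
  (Submodule.span ℤ (range x)).toAddSubgroup

theorem mem_genericGroup {I : Type} (x : I → ℝ) (i : I) : x i ∈ genericGroup x :=
  Submodule.subset_span (mem_range_self i)

theorem mk_genericGroup {I : Type} {x : I → ℝ} (hx : Function.Injective x) (hI : #I = 𝔠) :
    #(genericGroup x) = 𝔠 := by
  refine le_antisymm ((mk_set_le _).trans_eq mk_real) (hI ▸ ?_)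
  exact mk_le_of_injective (f := fun i => (⟨x i, mem_genericGroup x i⟩ : genericGroup x))
    fun i j h => hx (Subtype.ext_iff.1 h)

/-- Finitely many group elements are integer combinations of one common increasing tuple of
generators, and there are only countably many integer coefficient arrays. -/
theorem IsSmallness.genericGroup_pow {P : ∀ (E : Type) [MeasurableSpace E], Set E → Prop}
    (hP : IsSmallness P) {I : Type} [LinearOrder I] {x : I → ℝ}
    (h : ∀ m, P _ (SelectionPrinciples.increasingTuples x m)) (m k : ℕ) :
    P (Fin m → Fin k → ℝ) {v | ∀ i j, v i j ∈ genericGroup x} := by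
  classical
  refine hP.mono _ _ _ ?_ (hP.iUnion (fun p : Σ N : ℕ, Fin m → Fin k → Fin N → ℤ =>
    (fun (w : Fin p.1 → ℝ) (i : Fin m) (j : Fin k) => ∑ t, (p.2 i j t : ℝ) * w t) ''
      SelectionPrinciples.increasingTuples x p.1) fun p => hP.image _ _ _ _ ?_ (h p.1))
  · intro v hv
    have : ∀ i j, ∃ c : I →₀ ℤ, (c.sum fun i a => a • x i) = v i j := fun i j =>
      Finsupp.mem_span_range_iff_exists_finsupp.1 (hv i j)
    choose c hc using this
    let T : Finset I := Finset.univ.biUnion fun i => Finset.univ.biUnion fun j => (c i j).support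
    let f := T.orderEmbOfFin rfl
    refine mem_iUnion.2 ⟨⟨T.card, fun i j t => c i j (f t)⟩, x ∘ f, ⟨f, f.strictMono, rfl⟩, ?_⟩
    ext i j
    rw [← hc i j, Finsupp.sum_of_support_subset (s := T) _ _ _ (by simp)]
    · conv_rhs => rw [← T.map_orderEmbOfFin_univ rfl, Finset.sum_map]
      simp [f]
    · intro a ha
      simp only [T, Finset.mem_biUnion, Finset.mem_univ, true_and]
      exact ⟨i, j, ha⟩
  · fun_prop

end SelectionPrinciples

namespace SelectionPrinciples

open Set Filter MeasureTheory Topology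

/-! ### Category -/

/-- The Kuratowski–Ulam theorem for comeagre sets. -/
theorem eventually_residual_section {X Y : Type*} [TopologicalSpace X] [TopologicalSpace Y]
    [SecondCountableTopology Y] {C : Set (X × Y)} (hC : C ∈ residual (X × Y)) :
    ∀ᶠ x in residual X, {y | (x, y) ∈ C} ∈ residual Y := by
  obtain ⟨S, hSo, hSd, hSc, hSC⟩ := mem_residual_iff.1 hC
  have key : ∀ U ∈ S, ∀ᶠ x in residual X, {y | (x, y) ∈ U} ∈ residual Y := by
    intro U hU
    obtain ⟨b, hbc, hbe, hb⟩ := TopologicalSpace.exists_countable_basis Y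
    -- The projection of the part of `U` over `V` is open and dense; a section of `U` meeting every
    -- basic open set is dense.
    have : ∀ V ∈ b, ∀ᶠ x in residual X, ∃ y ∈ V, (x, y) ∈ U := by
      intro V hV
      have hVo := hb.isOpen hV
      have hVn : V.Nonempty := nonempty_iff_ne_empty.2 fun h => hbe (h ▸ hV)
      have he : {x | ∃ y ∈ V, (x, y) ∈ U} = Prod.fst '' (U ∩ Set.univ ×ˢ V) := by
        ext x
        constructor
        · rintro ⟨y, hy, hxy⟩
          exact ⟨(x, y), ⟨hxy, ⟨trivial, hy⟩⟩, rfl⟩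
        · rintro ⟨⟨x, y⟩, ⟨hxy, ⟨-, hy⟩⟩, rfl⟩
          exact ⟨y, hy, hxy⟩
      refine residual_of_dense_open ?_ ?_
      · rw [he]
        exact isOpenMap_fst _ ((hSo U hU).inter (isOpen_univ.prod hVo))
      · refine dense_iff_inter_open.2 fun W hW hWn => ?_
        obtain ⟨⟨x, y⟩, hxW, hxU⟩ :=
          (hSd U hU).inter_open_nonempty (W ×ˢ V) (hW.prod hVo) (hWn.prod hVn)
        exact ⟨x, hxW.1, y, hxW.2, hxU⟩
    filter_upwards [(eventually_countable_ball hbc).2 this] with x hx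
    refine residual_of_dense_open ((hSo U hU).preimage (by fun_prop)) ?_
    refine hb.dense_iff.2 fun V hV _ => ?_
    obtain ⟨y, hy, hxy⟩ := hx V hV
    exact ⟨y, hy, hxy⟩
  filter_upwards [(eventually_countable_ball hSc).2 key] with x hx
  refine mem_of_superset ((countable_bInter_mem hSc).2 hx) fun y hy => hSC ?_
  exact mem_sInter.2 fun U hU => mem_iInter₂.1 hy U hU

theorem isFubiniFamily_residual :
    IsFubiniFamily (residual ℝ) (fun m => residual (Fin m → ℝ)) where
  neBot := forall_mem_nonempty_iff_neBot.1 fun _ hs => (dense_of_mem_residual hs).nonempty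
  countableInter := inferInstance
  ne a := residual_of_dense_open isOpen_compl_singleton (dense_compl_singleton a)
  zero C hC v := by
    obtain ⟨w, hw⟩ := (dense_of_mem_residual hC).nonempty
    rwa [Subsingleton.elim v w]
  one C hC := (tendsto_residual_of_isOpenMap (f := fun v : Fin 1 → ℝ => v 0)
    (continuous_apply 0) (isOpenMap_eval 0)) hC
  succ m C hC := eventually_residual_section
    ((tendsto_residual_of_isOpenMap (Fin.consEquivL ℝ fun _ : Fin (m + 1) => ℝ).continuous
      (Fin.consEquivL ℝ fun _ : Fin (m + 1) => ℝ).toHomeomorph.isOpenMap) hC)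

/-- Sequences of countable Borel covers of a Baire space admit choices with comeagre union. -/
theorem exists_iUnion_mem_residual {E : Type} [TopologicalSpace E] [SecondCountableTopology E]
    [BaireSpace E] [MeasurableSpace E] [BorelSpace E] {B : ℕ → ℕ → Set E}
    (hB : ∀ n j, MeasurableSet (B n j)) (hu : ∀ n, ⋃ j, B n j = Set.univ) :
    ∃ g : ℕ → ℕ, ⋃ n, B n (g n) ∈ residual E := by
  obtain ⟨b, hbc, hbe, hb⟩ := TopologicalSpace.exists_countable_basis E
  rcases b.eq_empty_or_nonempty with rfl | hbn
  · refine ⟨0, ?_⟩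
    convert univ_mem
    have : IsEmpty E := ⟨fun x => by
      obtain ⟨V, hV, -⟩ := hb.exists_subset_of_mem_open (mem_univ x) isOpen_univ
      exact hV⟩
    exact Subsingleton.elim _ _
  obtain ⟨V, rfl⟩ := hbc.exists_eq_range hbn
  -- The `n`-th cover is spent on the `n`-th basic open set, which is nonmeagre and so has a
  -- nonmeagre trace on some member.
  have : ∀ n, ∃ j, ¬ IsMeagre (V n ∩ B n j) := by
    intro n
    by_contra! h
    have hV : ¬ IsMeagre (V n) := not_isMeagre_of_isOpen (hb.isOpen (mem_range_self n))
      (nonempty_iff_ne_empty.2 fun h => hbe (h ▸ mem_range_self n))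
    refine hV ((isMeagre_iUnion h).mono ?_)
    rw [← inter_iUnion, hu n, inter_univ]
  choose g hg using this
  refine ⟨g, ?_⟩
  have hm : MeasurableSet (⋃ n, B n (g n))ᶜ := (MeasurableSet.iUnion fun n => hB n _).compl
  -- By the Baire property the uncovered set is open modulo meagre. A nonempty such `U` would
  -- contain some `V n`, making the chosen trace meagre.
  obtain ⟨U, hU, hUe⟩ := hm.residualEq_isOpen
  rcases U.eq_empty_or_nonempty with rfl | ⟨x, hx⟩
  · filter_upwards [hUe.mem_iff] with y hy
    simpa using hy
  · exfalso
    obtain ⟨_, ⟨n, rfl⟩, -, hV⟩ := hb.exists_subset_of_mem_open hx hU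
    refine hg n ?_
    change _ ∈ residual E
    filter_upwards [hUe.mem_iff] with y hy
    rintro ⟨hyV, hyB⟩
    exact hy.2 (hV hyV) (mem_iUnion.2 ⟨n, hyB⟩)

/-- Even-numbered covers take care of a comeagre set, odd-numbered ones of the remainder. -/
theorem isBorelRothberger_of_residual {E : Type} [TopologicalSpace E] [SecondCountableTopology E]
    [BaireSpace E] [MeasurableSpace E] [BorelSpace E] (s : Set E)
    (h : ∀ C, MeasurableSet C → C ∈ residual E → IsBorelRothberger E (s \ C)) :
    IsBorelRothberger E s := by
  intro B hB hs
  obtain ⟨B', hB', hu, hsub⟩ := exists_measurable_cover_univ hB hs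
  obtain ⟨g, hg⟩ := exists_iUnion_mem_residual (fun n => hB' (2 * n)) fun n => hu (2 * n)
  obtain ⟨g', hg'⟩ := h _ (MeasurableSet.iUnion fun n => hB' (2 * n) (g n)) hg
    (fun n => B (2 * n + 1)) (fun n => hB _) fun n => sdiff_subset.trans (hs _)
  refine ⟨fun n => if n % 2 = 0 then g (n / 2) else g' (n / 2), fun x hx => ?_⟩
  by_cases hxC : x ∈ ⋃ n, B' (2 * n) (g n)
  · obtain ⟨n, hn⟩ := mem_iUnion.1 hxC
    exact mem_iUnion.2 ⟨2 * n, by simpa using hsub _ _ x hx hn⟩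
  · obtain ⟨n, hn⟩ := mem_iUnion.1 (hg' ⟨hx, hxC⟩)
    refine mem_iUnion.2 ⟨2 * n + 1, ?_⟩
    simpa [show (2 * n + 1) / 2 = n by omega] using hn

/-! ### Measure -/

theorem isFubiniFamily_ae :
    IsFubiniFamily (ae (volume : Measure ℝ)) (fun m => ae (volume : Measure (Fin m → ℝ))) where
  neBot := inferInstance
  countableInter := inferInstance
  ne a := by simp [ae_iff]
  zero C hC v := by
    obtain ⟨w, hw⟩ := Filter.nonempty_of_mem hC
    rwa [Subsingleton.elim v w]
  one C hC := (volume_preserving_funUnique (Fin 1) ℝ).quasiMeasurePreserving.ae hC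
  succ m C hC := by
    have h := (volume_preserving_piFinSuccAbove (fun _ : Fin (m + 1) => ℝ) 0).symm
    have h2 := Measure.ae_ae_of_ae_prod (h.quasiMeasurePreserving.ae (p := fun v => v ∈ C) hC)
    filter_upwards [h2] with x hx
    filter_upwards [hx] with y hy
    simpa [MeasurableEquiv.piFinSuccAbove, Fin.consEquiv] using hy

/-- Borel–Cantelli: finitely many members of the `n`-th cover leave out a set of measure below a
summable `ε n`. Passing to a finite measure with at least as many null sets allows continuity from
above. -/
theorem exists_ae_eventually_mem {E : Type} [MeasurableSpace E] {μ : Measure E} [SigmaFinite μ]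
    {B : ℕ → ℕ → Set E} (hB : ∀ n j, MeasurableSet (B n j)) (hu : ∀ n, ⋃ j, B n j = Set.univ) :
    ∃ g : ℕ → ℕ, ∀ᵐ x ∂μ, ∀ᶠ n in atTop, ∃ j ≤ g n, x ∈ B n j := by
  obtain ⟨ν, hν, hμν, -⟩ := exists_isFiniteMeasure_absolutelyContinuous μ
  let D (n k : ℕ) : Set E := (⋃ j ≤ k, B n j)ᶜ
  have hD (n : ℕ) : Tendsto (fun k => ν (D n k)) atTop (𝓝 0) := by
    have h0 : ⋂ k, D n k = ∅ := by
      refine eq_empty_of_forall_notMem fun x hx => ?_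
      obtain ⟨j, hj⟩ := mem_iUnion.1 ((hu n).symm ▸ mem_univ x)
      exact mem_iInter.1 hx j (mem_iUnion₂.2 ⟨j, le_rfl, hj⟩)
    rw [← measure_empty (μ := ν), ← h0]
    refine tendsto_measure_iInter_atTop (fun k => ?_) (fun k k' hk => ?_) ⟨0, measure_ne_top _ _⟩
    · exact (MeasurableSet.biUnion (to_countable _) fun j _ => hB n j).compl.nullMeasurableSet
    · exact compl_subset_compl.2 (biUnion_subset_biUnion_left fun j (hj : j ≤ k) => hj.trans hk)
  obtain ⟨ε, hε, hεs⟩ := ENNReal.exists_pos_sum_of_countable' one_ne_zero ℕ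
  have : ∀ n, ∃ k, ν (D n k) < ε n := fun n => ((hD n).eventually_lt_const (hε n)).exists
  choose g hg using this
  refine ⟨g, hμν.ae_le ?_⟩
  have hs : ∑' n, ν (D n (g n)) ≠ ⊤ :=
    ((ENNReal.tsum_le_tsum fun n => (hg n).le).trans_lt (hεs.trans ENNReal.one_lt_top)).ne
  filter_upwards [ae_eventually_notMem hs] with x hx
  filter_upwards [hx] with n hn
  simpa [D] using hn

theorem isBorelHurewicz_of_ae {E : Type} [MeasurableSpace E] (μ : Measure E) [SigmaFinite μ]
    (s : Set E) (h : ∀ C, MeasurableSet C → C ∈ ae μ → IsBorelHurewicz E (s \ C)) :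
    IsBorelHurewicz E s := by
  intro B hB hs
  obtain ⟨B', hB', hu, hsub⟩ := exists_measurable_cover_univ hB hs
  obtain ⟨g, hg⟩ := exists_ae_eventually_mem (μ := μ) hB' hu
  have hm : MeasurableSet {x | ∀ᶠ n in atTop, ∃ j ≤ g n, x ∈ B' n j} := by
    simp only [eventually_atTop]
    have : {x | ∃ a, ∀ n ≥ a, ∃ j ≤ g n, x ∈ B' n j} =
        ⋃ a, ⋂ n ≥ a, ⋃ j ≤ g n, B' n j := by
      ext x
      simp
    rw [this]
    exact MeasurableSet.iUnion fun a => MeasurableSet.biInter (to_countable _) fun n _ =>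
      MeasurableSet.biUnion (to_countable _) fun j _ => hB' n j
  obtain ⟨g', hg'⟩ := h _ hm hg B hB fun n => sdiff_subset.trans (hs _)
  refine ⟨fun n => max (g n) (g' n), fun x hx => ?_⟩
  by_cases hxC : ∀ᶠ n in atTop, ∃ j ≤ g n, x ∈ B' n j
  · refine hxC.mono ?_
    rintro n ⟨j, hj, hxj⟩
    exact ⟨j, le_max_of_le_left hj, hsub _ _ x hx hxj⟩
  · refine (hg' x ⟨hx, hxC⟩).mono ?_
    rintro n ⟨j, hj, hxj⟩
    exact ⟨j, le_max_of_le_right hj, hxj⟩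

end SelectionPrinciples

namespace SelectionPrinciples

open Set Filter

/-! ### Selection principles for subspaces -/

/-- A countable family of Borel subsets of a space `Y` embedded in `E` is enumerated by traces of
Borel subsets of `E`. -/
theorem exists_measurable_enumeration {Y E : Type} [TopologicalSpace Y] [TopologicalSpace E]
    [MeasurableSpace E] [BorelSpace E] {f : Y → E} (hf : Topology.IsInducing f)
    {𝒰 : Set (Set Y)} (hne : 𝒰.Nonempty) (hc : 𝒰.Countable)
    (hm : ∀ U ∈ 𝒰, @MeasurableSet Y (borel Y) U) :
    ∃ B : ℕ → Set E, (∀ j, MeasurableSet (B j)) ∧ range (fun j => f ⁻¹' B j) = 𝒰 := by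
  obtain ⟨u, rfl⟩ := hc.exists_eq_range hne
  have : ∀ j, ∃ B : Set E, MeasurableSet B ∧ f ⁻¹' B = u j := by
    intro j
    have h := hm (u j) (mem_range_self j)
    rw [hf.eq_induced, borel_comap, ← BorelSpace.measurable_eq (α := E)] at h
    exact h
  choose B hB hBu using this
  exact ⟨B, hB, by simp [hBu]⟩

theorem IsOmegaFamily.isCover {Y : Type} {𝒰 : Set (Set Y)} (h : IsOmegaFamily Y 𝒰)
    (hu : Set.univ ∉ 𝒰) : IsCover Y 𝒰 := by
  refine ⟨eq_univ_of_forall fun y => ?_, hu⟩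
  obtain ⟨U, hU, hyU⟩ := h {y} (finite_singleton y)
  exact ⟨U, hU, hyU rfl⟩

theorem mem_borelOmegaCovers_of_subset {Y : Type} [TopologicalSpace Y] {𝒰 : ℕ → Set (Set Y)}
    (h𝒰 : ∀ n, 𝒰 n ∈ BorelOmegaCovers Y) {𝒱 : Set (Set Y)} (h𝒱 : 𝒱 ⊆ ⋃ n, 𝒰 n)
    (h : IsOmegaFamily Y 𝒱) : 𝒱 ∈ BorelOmegaCovers Y := by
  refine ⟨⟨h.isCover fun hu => ?_, ?_, fun U hU => ?_⟩, h⟩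
  · obtain ⟨n, hn⟩ := mem_iUnion.1 (h𝒱 hu)
    exact (h𝒰 n).1.1.2 hn
  · exact (countable_iUnion fun n => (h𝒰 n).1.2.1).mono h𝒱
  · obtain ⟨n, hn⟩ := mem_iUnion.1 (h𝒱 hU)
    exact (h𝒰 n).1.2.2 U hn

theorem exists_fin_range_eq {Y : Type} {F : Set Y} (hF : F.Finite) :
    ∃ (m : ℕ) (v : Fin m → Y), range v = F := by
  obtain ⟨m, v, -, hv⟩ := hF.fin_param
  exact ⟨m, v, hv⟩

section Powers

variable {Y E : Type} [TopologicalSpace Y] [TopologicalSpace E] [MeasurableSpace E] [BorelSpace E]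
  {f : Y → E}

theorem exists_measurable_enumerations (hf : Topology.IsInducing f) {𝒰 : ℕ → Set (Set Y)}
    (h𝒰 : ∀ n, 𝒰 n ∈ BorelOmegaCovers Y) :
    ∃ B : ℕ → ℕ → Set E, (∀ n j, MeasurableSet (B n j)) ∧
      (∀ n, range (fun j => f ⁻¹' B n j) = 𝒰 n) ∧
      (∀ m n j, MeasurableSet {v : Fin m → E | ∀ i, v i ∈ B n j}) ∧
      ∀ m n, {v : Fin m → E | ∀ i, v i ∈ range f} ⊆ ⋃ j, {v | ∀ i, v i ∈ B n j} := by
  have hne (n : ℕ) : (𝒰 n).Nonempty := by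
    obtain ⟨U, hU, -⟩ := (h𝒰 n).2 ∅ finite_empty
    exact ⟨U, hU⟩
  choose B hB hBr using fun n =>
    exists_measurable_enumeration hf (hne n) (h𝒰 n).1.2.1 (h𝒰 n).1.2.2
  refine ⟨B, hB, hBr, fun m n j => ?_, fun m n v hv => ?_⟩
  · rw [ofPred_forall]
    exact MeasurableSet.iInter fun i => measurable_pi_apply i (hB n j)
  · choose w hw using hv
    obtain ⟨U, hU, hwU⟩ := (h𝒰 n).2 (range w) (finite_range w)
    rw [← hBr n] at hU
    obtain ⟨j, rfl⟩ := hU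
    exact mem_iUnion.2 ⟨j, fun i => hw i ▸ hwU (mem_range_self i)⟩

/-- An `m`-point subset lies in `U` exactly when the corresponding `m`-tuple lies in `U^m`, so an
ω-cover yields a cover of each power. The pairing function reserves infinitely many covers for each
`m`. -/
theorem s1BOmegaBOmega_of_isBorelRothberger (hf : Topology.IsInducing f)
    (h : ∀ m : ℕ, IsBorelRothberger (Fin m → E) {v | ∀ i, v i ∈ range f}) :
    S1BOmegaBOmega Y := by
  intro 𝒰 h𝒰
  obtain ⟨B, hB, hBr, hBm, hBc⟩ := exists_measurable_enumerations hf h𝒰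
  choose g hg using fun m => h m (fun n j => {v | ∀ i, v i ∈ B (Nat.pair m n) j})
    (fun n j => hBm m _ j) fun n => hBc m _
  let U (n : ℕ) : Set Y := f ⁻¹' B n (g n.unpair.1 n.unpair.2)
  have hU (n : ℕ) : U n ∈ 𝒰 n := hBr n ▸ mem_range_self _
  refine ⟨U, hU, mem_borelOmegaCovers_of_subset h𝒰 ?_ fun F hF => ?_⟩
  · rintro _ ⟨n, rfl⟩
    exact mem_iUnion.2 ⟨n, hU n⟩
  · obtain ⟨m, v, rfl⟩ := exists_fin_range_eq hF
    obtain ⟨n, hn⟩ := mem_iUnion.1 (hg m (show f ∘ v ∈ _ from fun i => mem_range_self _))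
    refine ⟨_, mem_range_self (Nat.pair m n), ?_⟩
    rintro _ ⟨i, rfl⟩
    simpa [U] using hn i

theorem sfinBOmegaBOmega_of_isBorelHurewicz (hf : Topology.IsInducing f)
    (h : ∀ m : ℕ, IsBorelHurewicz (Fin m → E) {v | ∀ i, v i ∈ range f}) :
    SfinBOmegaBOmega Y := by
  intro 𝒰 h𝒰
  obtain ⟨B, hB, hBr, hBm, hBc⟩ := exists_measurable_enumerations hf h𝒰
  choose g hg using fun m => h m (fun n j => {v | ∀ i, v i ∈ B (Nat.pair m n) j})
    (fun n j => hBm m _ j) fun n => hBc m _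
  let ℱ (n : ℕ) : Set (Set Y) := (fun j => f ⁻¹' B n j) '' Iic (g n.unpair.1 n.unpair.2)
  have hℱ (n : ℕ) : ℱ n ⊆ 𝒰 n := by
    rintro _ ⟨j, -, rfl⟩
    exact hBr n ▸ mem_range_self _
  refine ⟨ℱ, fun n => ⟨hℱ n, (finite_Iic _).image _⟩,
    mem_borelOmegaCovers_of_subset h𝒰 (iUnion_mono hℱ) fun F hF => ?_⟩
  obtain ⟨m, v, rfl⟩ := exists_fin_range_eq hF
  obtain ⟨n, j, hj, hn⟩ := (hg m (f ∘ v) fun i => mem_range_self _).exists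
  refine ⟨_, mem_iUnion.2 ⟨Nat.pair m n, mem_image_of_mem _ (show j ∈ Iic _ by simpa using hj)⟩, ?_⟩
  rintro _ ⟨i, rfl⟩
  exact hn i

end Powers

/-- A γ-cover must be infinite, so the selected sets have to be pairwise distinct. -/
theorem exists_injective_ge (g : ℕ → ℕ) {Z : Type} (u : ℕ → ℕ → Z)
    (hu : ∀ n, Function.Injective (u n)) :
    ∃ i : ℕ → ℕ, (∀ n, g n ≤ i n) ∧ Function.Injective fun n => u n (i n) := by
  classical
  have step : ∀ (n : ℕ) (S : Finset Z), ∃ j, g n ≤ j ∧ u n j ∉ S := by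
    intro n S
    have h : (u n '' Ici (g n)).Infinite := (Set.Ici_infinite _).image (hu n).injOn
    obtain ⟨_, ⟨j, hj, rfl⟩, hjS⟩ := h.exists_notMem_finset S
    exact ⟨j, hj, hjS⟩
  choose c hc hcS using step
  let T : ℕ → Finset Z := fun n => Nat.rec ∅ (fun n S => insert (u n (c n S)) S) n
  have hT : ∀ n, T (n + 1) = insert (u n (c n (T n))) (T n) := fun n => rfl
  have hmono : Monotone T := monotone_nat_of_le_succ fun n => hT n ▸ Finset.subset_insert _ _
  have hlt : ∀ n k, n < k → u n (c n (T n)) ≠ u k (c k (T k)) := by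
    intro n k hnk h
    refine hcS k (T k) (h ▸ hmono (Nat.succ_le_of_lt hnk) ?_)
    rw [Nat.succ_eq_add_one, hT]
    exact Finset.mem_insert_self _ _
  refine ⟨fun n => c n (T n), fun n => hc _ _, fun n k h => ?_⟩
  by_contra hne
  rcases lt_or_gt_of_ne hne with hl | hl
  · exact hlt _ _ hl h
  · exact hlt _ _ hl h.symm

/-- Hurewicz's property is applied to the tails `⋂ i ≥ j, B n i`. These increase with `j`, so any
single member of index at least `g n` does the work of the finite subfamily. -/
theorem s1BGammaBGamma_of_isBorelHurewicz {Y E : Type} [TopologicalSpace Y] [TopologicalSpace E]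
    [MeasurableSpace E] [BorelSpace E] {f : Y → E} (hf : Topology.IsInducing f)
    (h : IsBorelHurewicz E (range f)) : S1BGammaBGamma Y := by
  intro 𝒰 h𝒰
  have hex : ∀ n, ∃ B : ℕ → Set E, (∀ j, MeasurableSet (B j)) ∧ (∀ j, f ⁻¹' B j ∈ 𝒰 n) ∧
      Function.Injective fun j => f ⁻¹' B j := by
    intro n
    let e := ((h𝒰 n).2.1).natEmbedding
    have : ∀ j, ∃ B : Set E, MeasurableSet B ∧ f ⁻¹' B = e j := by
      intro j
      have h := (h𝒰 n).1.2.2 (e j) (e j).2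
      rw [hf.eq_induced, borel_comap, ← BorelSpace.measurable_eq (α := E)] at h
      exact h
    choose B hB hBe using this
    refine ⟨B, hB, fun j => hBe j ▸ (e j).2, fun i j hij => e.injective (Subtype.ext ?_)⟩
    simpa [hBe] using hij
  choose B hB hBU hBi using hex
  have hfin (n : ℕ) (y : Y) : ∃ j, ∀ i ≥ j, f y ∈ B n i := by
    have : {i | f y ∉ B n i}.Finite :=
      Finite.of_injOn (f := fun j => f ⁻¹' B n j) (t := {U ∈ 𝒰 n | y ∉ U})
        (fun i hi => ⟨hBU n i, hi⟩) (hBi n).injOn ((h𝒰 n).2.2 y)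
    obtain ⟨j, hj⟩ := this.bddAbove
    exact ⟨j + 1, fun i hi => by_contra fun hc => absurd (hj hc) (by omega)⟩
  obtain ⟨g, hg⟩ := h (fun n j => ⋂ i ≥ j, B n i)
    (fun n j => MeasurableSet.biInter (to_countable _) fun i _ => hB n i) (by
      rintro n _ ⟨y, rfl⟩
      obtain ⟨j, hj⟩ := hfin n y
      exact mem_iUnion.2 ⟨j, mem_iInter₂.2 hj⟩)
  obtain ⟨i, hi, hinj⟩ := exists_injective_ge g (fun n j => f ⁻¹' B n j) hBi
  have hev (y : Y) : {n | y ∉ f ⁻¹' B n (i n)}.Finite := by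
    rw [← Nat.cofinite_eq_atTop] at hg
    refine (hg (f y) (mem_range_self y)).subset fun n hn hc => ?_
    obtain ⟨j, hj, hy⟩ := hc
    exact hn (mem_iInter₂.1 hy (i n) (hj.trans (hi n)))
  have hγ : IsGammaFamily Y (range fun n => f ⁻¹' B n (i n)) := by
    refine ⟨infinite_range_of_injective hinj, fun y =>
      ((hev y).image fun n => f ⁻¹' B n (i n)).subset ?_⟩
    rintro _ ⟨⟨n, rfl⟩, hn⟩
    exact ⟨n, hn, rfl⟩
  refine ⟨_, fun n => hBU n (i n), ⟨⟨eq_univ_of_forall fun y => ?_, ?_⟩, countable_range _, ?_⟩, hγ⟩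
  · obtain ⟨n, hn⟩ := (hev y).exists_notMem
    exact ⟨_, mem_range_self n, not_not.1 hn⟩
  · rintro ⟨n, hn⟩
    exact (h𝒰 n).1.1.2 (hn ▸ hBU n (i n))
  · rintro _ ⟨n, rfl⟩
    exact (h𝒰 n).1.2.2 _ (hBU n (i n))

/-- The inclusion of a subspace of a power of a subgroup of the real line. -/
def powerInclusion {G : AddSubgroup ℝ} {k : ℕ} (Y : Set (Fin k → G)) (y : Y) : Fin k → ℝ :=
  fun j => y.1 j

theorem isInducing_powerInclusion {G : AddSubgroup ℝ} {k : ℕ} (Y : Set (Fin k → G)) :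
    Topology.IsInducing (powerInclusion Y) :=
  (Topology.IsInducing.piMap fun _ : Fin k => Topology.IsInducing.subtypeVal).comp
    Topology.IsInducing.subtypeVal

end SelectionPrinciples

namespace SelectionPrinciples

open Set Filter MeasureTheory Topology

/-! ### Groups generated by generic sequences -/

theorem IsGenericSeq.exists_mem {l : Filter ℝ} {F : ∀ m : ℕ, Filter (Fin m → ℝ)}
    (hF : IsFubiniFamily l F) {I : Type} [LinearOrder I] {x : I → ℝ} (hx : IsGenericSeq F x)
    {C : Set ℝ} (hC : MeasurableSet C) (hCl : C ∈ l) : ∃ i, x i ∈ C := by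
  obtain ⟨b, hb⟩ := hx 1 {v | v 0 ∈ C} (measurable_pi_apply 0 hC) (hF.one C hCl)
  exact ⟨b, hb (fun _ => b) (Subsingleton.strictMono _) fun _ => le_rfl⟩

theorem not_isMeagre_genericGroup {I : Type} [LinearOrder I] {x : I → ℝ}
    (hx : IsGenericSeq (fun m => residual (Fin m → ℝ)) x) :
    ¬ IsMeagre (genericGroup x : Set ℝ) := by
  intro h
  obtain ⟨t, hts, ht, htd⟩ := mem_residual.1 h
  obtain ⟨i, hi⟩ := hx.exists_mem isFubiniFamily_residual ht.measurableSet
    (residual_of_dense_Gδ ht htd)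
  exact hts hi (mem_genericGroup x i)

theorem volume_genericGroup_ne_zero {I : Type} [LinearOrder I] {x : I → ℝ}
    (hx : IsGenericSeq (fun m => ae (volume : Measure (Fin m → ℝ))) x) :
    volume (genericGroup x : Set ℝ) ≠ 0 := by
  intro h
  obtain ⟨t, hts, ht, ht0⟩ := exists_measurable_superset_of_null h
  obtain ⟨i, hi⟩ := hx.exists_mem isFubiniFamily_ae ht.compl (compl_mem_ae_iff.2 ht0)
  exact hi (hts (mem_genericGroup x i))

theorem dense_of_mk_eq_continuum {G : AddSubgroup ℝ} (hG : #G = 𝔠) : Dense (G : Set ℝ) := by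
  rcases G.dense_or_cyclic with h | ⟨a, rfl⟩
  · exact h
  · exfalso
    have hc : (AddSubgroup.closure {a} : Set ℝ).Countable := by
      rw [← AddSubgroup.zmultiples_eq_closure, AddSubgroup.coe_zmultiples]
      exact countable_range _
    have := hc.le_aleph0
    exact (this.trans_lt aleph0_lt_continuum).ne hG

/-! ### Failure of selection principles -/

/-- Strong measure zero implies null: the lengths of the balls can be prescribed with sum below any
positive bound. -/
theorem volume_eq_zero_of_forall_subset_iUnion_ball {s : Set ℝ}
    (h : ∀ r : ℕ → ℝ, (∀ n, 0 < r n) → ∃ c : ℕ → ℝ, s ⊆ ⋃ n, Metric.ball (c n) (r n)) :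
    volume s = 0 := by
  by_contra h0
  obtain ⟨ε, hε, hs⟩ := ENNReal.exists_pos_sum_of_countable h0 ℕ
  obtain ⟨c, hc⟩ := h (fun n => ε n / 2) fun n => half_pos (hε n)
  refine hs.not_ge ((measure_mono hc).trans ((measure_iUnion_le _).trans ?_))
  refine ENNReal.tsum_le_tsum fun n => ?_
  rw [Real.volume_ball, mul_div_cancel₀ _ two_ne_zero, ENNReal.ofReal_coe_nnreal]

theorem iUnion_ball_denseSeq {r : ℝ} (hr : 0 < r) :
    ⋃ j, Metric.ball (TopologicalSpace.denseSeq ℝ j) r = Set.univ := by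
  refine eq_univ_of_forall fun x => ?_
  obtain ⟨j, hj⟩ := (TopologicalSpace.denseRange_denseSeq ℝ).exists_dist_lt x hr
  exact mem_iUnion.2 ⟨j, hj⟩

theorem IsBorelRothberger.volume_eq_zero {s : Set ℝ} (hs : IsBorelRothberger ℝ s) :
    volume s = 0 := by
  refine volume_eq_zero_of_forall_subset_iUnion_ball fun r hr => ?_
  obtain ⟨g, hg⟩ := hs (fun n j => Metric.ball (TopologicalSpace.denseSeq ℝ j) (r n))
    (fun n j => measurableSet_ball) fun n => (iUnion_ball_denseSeq (hr n)).symm ▸ subset_univ s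
  exact ⟨fun n => TopologicalSpace.denseSeq ℝ (g n), hg⟩

theorem S1OO.volume_eq_zero {G : AddSubgroup ℝ} (hG : Dense (G : Set ℝ)) (h : S1OO G) :
    volume (G : Set ℝ) = 0 := by
  refine volume_eq_zero_of_forall_subset_iUnion_ball fun r hr => ?_
  let B (n j : ℕ) : Set ℝ := Metric.ball (TopologicalSpace.denseSeq ℝ j) (r n)
  obtain ⟨U, hU, hcov⟩ := h (fun n => range fun j => ((↑) : G → ℝ) ⁻¹' B n j) (by
    intro n
    refine ⟨⟨?_, ?_⟩, ?_⟩
    · rw [sUnion_range, ← preimage_iUnion, iUnion_ball_denseSeq (hr n), preimage_univ]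
    · rintro ⟨j, hj⟩
      -- A cover may not contain the whole space; density puts a point of `G` outside each ball.
      obtain ⟨y, hy, hyG⟩ := hG.inter_open_nonempty
        (Metric.closedBall (TopologicalSpace.denseSeq ℝ j) (r n))ᶜ
        Metric.isClosed_closedBall.isOpen_compl
        ⟨TopologicalSpace.denseSeq ℝ j + (r n + 1), by
          simp [abs_of_pos (add_pos (hr n) one_pos)]⟩
      have : (⟨y, hyG⟩ : G) ∈ ((↑) : G → ℝ) ⁻¹' B n j :=
        (show ((↑) : G → ℝ) ⁻¹' B n j = Set.univ from hj) ▸ mem_univ _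
      exact hy (Metric.ball_subset_closedBall this)
    · rintro _ ⟨j, rfl⟩
      exact Metric.isOpen_ball.preimage continuous_subtype_val)
  choose j hj using hU
  refine ⟨fun n => TopologicalSpace.denseSeq ℝ (j n), fun y hy => ?_⟩
  have hy' : (⟨y, hy⟩ : G) ∈ ⋃₀ range U := hcov.1.1 ▸ mem_univ _
  obtain ⟨_, ⟨n, rfl⟩, hn⟩ := hy'
  rw [← hj n] at hn
  exact mem_iUnion.2 ⟨n, hn⟩

theorem isMeagre_of_countable {s : Set ℝ} (hs : s.Countable) : IsMeagre s := by
  refine mem_of_superset ((eventually_countable_ball hs).2 fun a _ => isFubiniFamily_residual.ne a)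
    fun y hy hys => hy y hys rfl

/-- If the complement of a countable dense set were an `F_σ`, its closed pieces would miss a dense
set and be nowhere dense, so the group would be meagre. -/
theorem not_isSigmaSpace_of_not_isMeagre {G : AddSubgroup ℝ} (hG : ¬ IsMeagre (G : Set ℝ)) :
    ¬ IsSigmaSpace G := by
  intro h
  obtain ⟨D, hDc, hDd⟩ := TopologicalSpace.exists_countable_dense G
  obtain ⟨C, hC, hDC⟩ := h Dᶜ (by
    rw [← BorelSpace.measurable_eq (α := G)]
    exact hDc.measurableSet.compl)
  have hm : IsMeagre Dᶜ := by
    rw [hDC]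
    refine isMeagre_iUnion fun n => ?_
    refine residual_of_dense_open (hC n).isOpen_compl (hDd.mono fun d hd hdC => ?_)
    exact (hDC.symm ▸ mem_iUnion.2 ⟨n, hdC⟩ : d ∈ Dᶜ) hd
  have hm' := hm.image_val
  refine hG ((hm'.union (isMeagre_of_countable (hDc.image ((↑) : G → ℝ)))).mono fun y hy => ?_)
  by_cases hyD : (⟨y, hy⟩ : G) ∈ D
  · exact Or.inr ⟨_, hyD, rfl⟩
  · exact Or.inl ⟨_, hyD, rfl⟩

/-- A nontrivial coset of a dense proper subgroup is dense and disjoint from it. -/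
theorem exists_denseRange_notMem {G : AddSubgroup ℝ} (hG : Dense (G : Set ℝ))
    (hne : (G : Set ℝ) ≠ Set.univ) : ∃ d : ℕ → ℝ, DenseRange d ∧ ∀ n, d n ∉ G := by
  obtain ⟨a, ha⟩ := (ne_univ_iff_exists_notMem _).1 hne
  have h1 : Dense ((fun y => a + y) '' (G : Set ℝ)) :=
    (Homeomorph.addLeft a).surjective.denseRange.dense_image (Homeomorph.addLeft a).continuous hG
  obtain ⟨D, hDs, hDc, hDd⟩ := h1.exists_countable_dense_subset
  obtain ⟨d, rfl⟩ := hDc.exists_eq_range hDd.nonempty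
  refine ⟨d, hDd, fun n hn => ?_⟩
  obtain ⟨y, hy, hyd⟩ := hDs (mem_range_self n)
  exact ha ((G.add_mem_cancel_right hy).1 ((show a + y = d n from hyd) ▸ hn : a + y ∈ G))

theorem not_ufinOGamma_of_not_isMeagre {G : AddSubgroup ℝ} (hG : ¬ IsMeagre (G : Set ℝ))
    (hGd : Dense (G : Set ℝ)) (hne : (G : Set ℝ) ≠ Set.univ) : ¬ UfinOGamma G := by
  intro h
  obtain ⟨d, hd, hdG⟩ := exists_denseRange_notMem hGd hne
  -- The traces of `W n j` increase to `G` with `j` because `G` avoids the points `d i`, but none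
  -- equals `G`, by density.
  let W (n j : ℕ) : Set ℝ := ⋂ i ∈ Iic n, {y | 1 / ((j : ℝ) + 1) < dist y (d i)}
  let 𝒰 (n : ℕ) : Set (Set G) := range fun j => ((↑) : G → ℝ) ⁻¹' W n j
  have hWmono (n : ℕ) : Monotone (W n) := fun j k hjk =>
    iInter₂_mono fun i _ => ofPred_subset_ofPred.2 fun y hy =>
      (Nat.one_div_le_one_div hjk).trans_lt hy
  have hWopen (n j : ℕ) : IsOpen (W n j) := (finite_Iic n).isOpen_biInter fun i _ =>
    isOpen_lt continuous_const (continuous_id.dist continuous_const)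
  have hWne (n j : ℕ) : ((↑) : G → ℝ) ⁻¹' W n j ≠ Set.univ := by
    intro hW
    obtain ⟨y, hy, hyG⟩ := hGd.inter_open_nonempty (Metric.ball (d 0) (1 / ((j : ℝ) + 1)))
      Metric.isOpen_ball ⟨d 0, Metric.mem_ball_self (by positivity)⟩
    have : (⟨y, hyG⟩ : G) ∈ ((↑) : G → ℝ) ⁻¹' W n j := hW ▸ mem_univ _
    exact lt_asymm (mem_iInter₂.1 this 0 (Nat.zero_le n)) (Metric.mem_ball.1 hy)
  have hWcov (n : ℕ) (y : G) : ∃ j, (y : ℝ) ∈ W n j := by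
    have : ∀ᶠ j : ℕ in atTop, ∀ i ∈ Iic n, 1 / ((j : ℝ) + 1) < dist (y : ℝ) (d i) :=
      (eventually_all_finite (finite_Iic n)).2 fun i _ =>
        tendsto_one_div_add_atTop_nhds_zero_nat.eventually_lt_const
          (dist_pos.2 fun hy => hdG i (hy ▸ y.2))
    obtain ⟨j, hj⟩ := this.exists
    exact ⟨j, mem_iInter₂.2 hj⟩
  have hbound (n : ℕ) (ℱ : Set (Set G)) (hℱ : ℱ ⊆ 𝒰 n) (hfin : ℱ.Finite) :
      ∃ J, ⋃₀ ℱ ⊆ ((↑) : G → ℝ) ⁻¹' W n J := by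
    choose! j hj using hℱ
    obtain ⟨J, hJ⟩ := (hfin.image j).bddAbove
    refine ⟨J, sUnion_subset fun U hU => ?_⟩
    rw [← hj hU]
    exact preimage_mono (hWmono n (hJ (mem_image_of_mem j hU)))
  obtain ⟨ℱ, hℱ, hcov⟩ := h 𝒰 (by
    intro n
    refine ⟨⟨eq_univ_of_forall fun y => ?_, ?_⟩, ?_⟩
    · obtain ⟨j, hj⟩ := hWcov n y
      exact ⟨_, mem_range_self j, hj⟩
    · rintro ⟨j, hj⟩
      exact hWne n j hj
    · rintro _ ⟨j, rfl⟩
      exact (hWopen n j).preimage continuous_subtype_val) (by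
    rintro n ⟨ℱ, hℱ, hfin, hu⟩
    obtain ⟨J, hJ⟩ := hbound n ℱ hℱ hfin
    exact hWne n J (univ_subset_iff.1 (hu ▸ hJ)))
  choose J hJ using fun n => hbound n (ℱ n) (hℱ n).1 (hℱ n).2
  obtain ⟨-, hinf, hγ⟩ := hcov
  -- The γ-condition counts distinct sets, not indices; choosing one index per distinct set gives an
  -- injective `k`, which therefore tends to infinity.
  let e := hinf.natEmbedding
  choose k hk using fun t => (e t).2
  have hkinj : Function.Injective k := fun s t hst =>
    e.injective (Subtype.ext (by rw [← hk s, ← hk t, hst]))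
  -- The intersection misses a ball around every `d i`, since `i ≤ k t` for some `t ≥ T`. Each point
  -- of `G` lies in one of these sets, which would make `G` meagre.
  have hN (T : ℕ) : IsMeagre (⋂ t ≥ T, W (k t) (J (k t))) := by
    refine mem_of_superset (residual_of_dense_open (s := ⋃ t ≥ T, ⋃ i ∈ Iic (k t),
      Metric.ball (d i) (1 / ((J (k t) : ℝ) + 1))) ?_ ?_) ?_
    · exact isOpen_biUnion fun t _ => isOpen_biUnion fun i _ => Metric.isOpen_ball
    · refine hd.mono ?_
      rintro _ ⟨i, rfl⟩
      obtain ⟨t, hti, htT⟩ := ((hkinj.nat_tendsto_atTop.eventually_ge_atTop i).and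
        (eventually_ge_atTop T)).exists
      exact mem_iUnion₂.2 ⟨t, htT, mem_iUnion₂.2 ⟨i, hti, Metric.mem_ball_self (by positivity)⟩⟩
    · intro y hy hyN
      obtain ⟨t, ht, hy⟩ := mem_iUnion₂.1 hy
      obtain ⟨i, hi, hy⟩ := mem_iUnion₂.1 hy
      exact lt_asymm (mem_iInter₂.1 (mem_iInter₂.1 hyN t ht) i hi) (Metric.mem_ball.1 hy)
  refine hG ((isMeagre_iUnion hN).mono fun y hy => ?_)
  have hf : {t | (⟨y, hy⟩ : G) ∉ (e t : Set G)}.Finite :=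
    Finite.of_injOn (f := fun t => (e t : Set G))
      (t := {U ∈ range fun n => ⋃₀ ℱ n | (⟨y, hy⟩ : G) ∉ U}) (fun t ht => ⟨(e t).2, ht⟩)
      (Subtype.val_injective.comp e.injective).injOn (hγ ⟨y, hy⟩)
  obtain ⟨T, hT⟩ := hf.bddAbove
  refine mem_iUnion.2 ⟨T + 1, mem_iInter₂.2 fun t ht => hJ (k t) (a := ⟨y, hy⟩) ?_⟩
  change (⟨y, hy⟩ : G) ∈ (fun n => ⋃₀ ℱ n) (k t)
  rw [hk t]
  by_contra hc
  exact absurd (hT hc) (by omega)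

/-! ### Positive results for generic groups -/

theorem IsSmallness.range_powerInclusion_pow
    {P : ∀ (E : Type) [MeasurableSpace E], Set E → Prop} (hP : IsSmallness P) {G : AddSubgroup ℝ}
    (h : ∀ m k, P (Fin m → Fin k → ℝ) {v | ∀ i j, v i j ∈ G}) {k : ℕ} (Y : Set (Fin k → G))
    (m : ℕ) : P (Fin m → Fin k → ℝ) {v | ∀ i, v i ∈ range (powerInclusion Y)} := by
  refine hP.mono _ _ _ ?_ (h m k)
  intro v hv i j
  obtain ⟨y, hy⟩ := hv i
  rw [← hy]
  exact (y.1 j).2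

theorem IsSmallness.of_pow_one {P : ∀ (E : Type) [MeasurableSpace E], Set E → Prop}
    (hP : IsSmallness P) {E : Type} [MeasurableSpace E] {s : Set E}
    (h : P (Fin 1 → E) {v | ∀ i, v i ∈ s}) : P E s :=
  hP.mono _ _ ((fun v : Fin 1 → E => v 0) '' {v | ∀ i, v i ∈ s})
    (fun y hy => ⟨fun _ => y, fun _ => hy, rfl⟩) (hP.image _ _ _ _ (measurable_pi_apply 0) h)

end SelectionPrinciples

/-! ### The two groups -/

theorem mainTheorem9 (CH : (𝔠 : Cardinal.{0}) = ℵ₁) :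
    (∃ G : AddSubgroup ℝ, #G = 𝔠 ∧
      (∀ k : ℕ, SelectionPrinciples.Hereditarily
        SelectionPrinciples.S1BOmegaBOmega (Fin k → G)) ∧
      ¬ SelectionPrinciples.IsSigmaSpace G ∧
      ¬ SelectionPrinciples.UfinOGamma G) ∧
    (∃ H : AddSubgroup ℝ, #H = 𝔠 ∧
      (∀ k : ℕ, SelectionPrinciples.Hereditarily
        SelectionPrinciples.S1BGammaBGamma (Fin k → H)) ∧
      (∀ k : ℕ, SelectionPrinciples.Hereditarily
        SelectionPrinciples.SfinBOmegaBOmega (Fin k → H)) ∧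
      ¬ SelectionPrinciples.S1OO H) := by
  open SelectionPrinciples in
  constructor
  · obtain ⟨I, _, x, hcard, hI, hinj, hx⟩ := exists_isGenericSeq CH isFubiniFamily_residual
    have hP := isSmallness_isBorelRothberger
    have hpow := hP.genericGroup_pow (hP.increasingTuples isFubiniFamily_residual
      (fun _ s => isBorelRothberger_of_residual s) hI hx)
    have hG := mk_genericGroup hinj hcard
    have hd := dense_of_mk_eq_continuum hG
    have hm := not_isMeagre_genericGroup hx
    -- This makes the group null, hence a proper subgroup of `ℝ`, as the failure of Hurewicz's
    -- property requires.
    have h1 : IsBorelRothberger ℝ (genericGroup x : Set ℝ) := by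
      refine hP.of_pow_one (hP.of_pow_one (hP.mono _ _ _ ?_ (hpow 1 1)))
      exact fun v hv i j => hv i j
    refine ⟨genericGroup x, hG, fun k Y => ?_, not_isSigmaSpace_of_not_isMeagre hm,
      not_ufinOGamma_of_not_isMeagre hm hd fun hu => ?_⟩
    · exact s1BOmegaBOmega_of_isBorelRothberger (isInducing_powerInclusion Y)
        (hP.range_powerInclusion_pow hpow Y)
    · have := h1.volume_eq_zero
      simp [hu] at this
  · obtain ⟨I, _, x, hcard, hI, hinj, hx⟩ := exists_isGenericSeq CH isFubiniFamily_ae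
    have hP := isSmallness_isBorelHurewicz
    have hpow := hP.genericGroup_pow (hP.increasingTuples isFubiniFamily_ae
      (fun _ s => isBorelHurewicz_of_ae MeasureTheory.volume s) hI hx)
    have hH := mk_genericGroup hinj hcard
    refine ⟨genericGroup x, hH, fun k Y => ?_, fun k Y => ?_, fun h => ?_⟩
    · exact s1BGammaBGamma_of_isBorelHurewicz (isInducing_powerInclusion Y)
        (hP.of_pow_one (hP.range_powerInclusion_pow hpow Y 1))
    · exact sfinBOmegaBOmega_of_isBorelHurewicz (isInducing_powerInclusion Y)
        (hP.range_powerInclusion_pow hpow Y)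
    · exact volume_genericGroup_ne_zero hx (h.volume_eq_zero (dense_of_mk_eq_continuum hH))
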